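/- Let $G$ be a finite simple graph with $n$ vertices and minimum degree $\delta$. A pebbling distribution assigns a nonnegative integer number of pebbles to each vertex; its size is the total number of pebbles. A pebbling move removes two pebbles from a vertex that has at least two and places one pebble on an adjacent vertex. The optimal pebbling number $\pi^*(G)$ is the smallest size of a distribution $D$ such that for every vertex $v$ there is a (possibly empty) sequence of pebbling moves starting from $D$ after which $v$ has at least one pebble. Every finite connected simple graph $G$ satisfies $$\pi^*(G) < \frac{4n}{\delta+1},$$ and this bound is sharp, already among graphs of diameter two: for every $\varepsilon>0$ there is a connected graph $G$ of diameter two such that $$\frac{\pi^*(G)(\delta+1)}{n} > 4-\varepsilon .$$ -/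

import Mathlib

namespace Pebbling

variable {V : Type*}

/-- `PebblingMove G D D'`: the distribution `D'` arises from `D` by one allowed pebbling move, which
removes two pebbles from a vertex `u` and places one on a neighbour `v` of `u`. The equation
`D u = D' u + 2` forces `u` to have at least two pebbles before the move. -/
def PebblingMove (G : SimpleGraph V) (D D' : V → ℕ) : Prop :=
  ∃ u v : V, G.Adj u v ∧ D u = D' u + 2 ∧ D' v = D v + 1 ∧ ∀ w, w ≠ u → w ≠ v → D' w = D w

/-- `v` is `k`-reachable under `D`: some (possibly empty) sequence of allowed pebbling moves
starting from `D` results in at least `k` pebbles on `v`. -/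
def Reachable (G : SimpleGraph V) (k : ℕ) (D : V → ℕ) (v : V) : Prop :=
  ∃ D' : V → ℕ, Relation.ReflTransGen (PebblingMove G) D D' ∧ k ≤ D' v

/-- A distribution is `k`-solvable if every vertex is `k`-reachable under it. -/
def Solvable (G : SimpleGraph V) (k : ℕ) (D : V → ℕ) : Prop :=
  ∀ v, Reachable G k D v

/-- The set of sizes of the `k`-solvable distributions on `G`. -/
def solvableSizes [Fintype V] (G : SimpleGraph V) (k : ℕ) : Set ℕ :=
  {s | ∃ D : V → ℕ, Solvable G k D ∧ ∑ v, D v = s}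

/-- The `k`-optimal pebbling number: the smallest size of a `k`-solvable distribution. -/
noncomputable def optimalPebblingNumberK [Fintype V] (G : SimpleGraph V) (k : ℕ) : ℕ :=
  sInf (solvableSizes G k)

/-- The optimal pebbling number `π*(G)`. -/
noncomputable def optimalPebblingNumber [Fintype V] (G : SimpleGraph V) : ℕ :=
  optimalPebblingNumberK G 1

/-- The infimum in the definition is an attained minimum. -/
theorem isLeast_optimalPebblingNumberK [Fintype V] (G : SimpleGraph V) (k : ℕ) :
    IsLeast (solvableSizes G k) (optimalPebblingNumberK G k) :=
  ⟨Nat.sInf_mem ⟨_, fun _ => k, fun _ => ⟨_, Relation.ReflTransGen.refl, le_rfl⟩, rfl⟩,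
    fun _ h => Nat.sInf_le h⟩

end Pebbling

namespace Pebbling

open Finset

variable {V : Type*} {G : SimpleGraph V}

/-! Upper bound: take a maximal set `S` of vertices with disjoint closed neighbourhoods, so `#S * (δ
+ 1) ≤ n`. By maximality every vertex is within distance two of `S`, so four pebbles on each vertex
of `S` suffice. Strictness: if the neighbourhoods cover the graph, two pebbles each suffice;
otherwise the count of `S` is strict. Sharpness: in the complement of the `m × m` rook's graph, `δ +
1 = (m - 1)² + 1` is close to `n = m²`, while any two vertices have a common non-neighbour, which
forces at least four pebbles (`four_le_optimalPebblingNumber`). -/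

theorem optimalPebblingNumber_le [Fintype V] {D : V → ℕ} (hD : Solvable G 1 D) :
    optimalPebblingNumber G ≤ ∑ v, D v :=
  (isLeast_optimalPebblingNumberK G 1).2 ⟨D, hD, rfl⟩

theorem exists_pebblingMove {D : V → ℕ} {u v : V} (huv : G.Adj u v) (hu : 2 ≤ D u) :
    ∃ D', PebblingMove G D D' ∧ D' u = D u - 2 ∧ D' v = D v + 1 := by
  classical
  refine ⟨Function.update (Function.update D u (D u - 2)) v (D v + 1),
    ⟨u, v, huv, ?_, ?_, ?_⟩, ?_, ?_⟩
  · rw [Function.update_of_ne huv.ne, Function.update_self]; omega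
  · simp
  · intro w hwu hwv
    rw [Function.update_of_ne hwv, Function.update_of_ne hwu]
  · rw [Function.update_of_ne huv.ne, Function.update_self]
  · simp

theorem reachable_of_le {k : ℕ} {D : V → ℕ} {v : V} (h : k ≤ D v) : Reachable G k D v :=
  ⟨D, Relation.ReflTransGen.refl, h⟩

theorem reachable_of_adj {D : V → ℕ} {u v : V} (huv : G.Adj u v) (hu : 2 ≤ D u) :
    Reachable G 1 D v := by
  obtain ⟨D', h, -, hv⟩ := exists_pebblingMove huv hu
  exact ⟨D', .single h, by omega⟩

theorem reachable_of_adj_adj {D : V → ℕ} {u x v : V} (hux : G.Adj u x) (hxv : G.Adj x v)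
    (hu : 4 ≤ D u) : Reachable G 1 D v := by
  obtain ⟨D₁, h₁, hu₁, hx₁⟩ := exists_pebblingMove hux (by omega : 2 ≤ D u)
  obtain ⟨D₂, h₂, -, hx₂⟩ := exists_pebblingMove hux (by omega : 2 ≤ D₁ u)
  obtain ⟨D₃, h₃, -, hv₃⟩ := exists_pebblingMove hxv (by omega : 2 ≤ D₂ x)
  exact ⟨D₃, ((Relation.ReflTransGen.single h₁).tail h₂).tail h₃, by omega⟩

/-- A maximal family of vertices with pairwise disjoint closed neighbourhoods. -/
theorem exists_maximal_disjoint_closedNbhds [Fintype V] [DecidableEq V] (G : SimpleGraph V)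
    [DecidableRel G.Adj] :
    ∃ S : Finset V,
      (S : Set V).PairwiseDisjoint (fun s => insert s (G.neighborFinset s)) ∧
      ∀ v, ∃ s ∈ S,
        ¬ Disjoint (insert s (G.neighborFinset s)) (insert v (G.neighborFinset v)) := by
  obtain ⟨S, hS⟩ := (Set.toFinite {S : Finset V |
    (S : Set V).PairwiseDisjoint (fun s => insert s (G.neighborFinset s))}).exists_maximal
      ⟨∅, by simp⟩
  refine ⟨S, hS.prop, fun v => ?_⟩
  by_contra! hv
  have hvS : v ∈ S := by
    refine hS.le_of_ge (y := insert v S) ?_ (subset_insert v S) (mem_insert_self v S)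
    simp only [Set.mem_ofPred_eq, coe_insert]
    exact hS.prop.insert fun s hs _ => (hv s hs).symm
  -- A closed neighbourhood contains its centre, so it is not disjoint from itself.
  have := hv v hvS
  simp at this

theorem optimalPebblingNumber_lt [Fintype V] (G : SimpleGraph V) [DecidableRel G.Adj]
    [Nonempty V] :
    (optimalPebblingNumber G : ℝ) < 4 * (Fintype.card V : ℝ) / ((G.minDegree : ℝ) + 1) := by
  classical
  obtain ⟨S, hdisj, hmax⟩ := exists_maximal_disjoint_closedNbhds G
  set N : V → Finset V := fun s => insert s (G.neighborFinset s) with hN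
  have hcardN (s : V) : G.minDegree + 1 ≤ #(N s) := by
    rw [hN, card_insert_of_notMem (by simp), G.card_neighborFinset_eq_degree]
    exact Nat.succ_le_succ (G.minDegree_le_degree s)
  have hlower : #S * (G.minDegree + 1) ≤ #(S.biUnion N) := by
    rw [card_biUnion fun s hs t ht hst => hdisj hs ht hst, ← smul_eq_mul]
    exact card_nsmul_le_sum _ _ _ fun s _ => hcardN s
  have hsum (k : ℕ) : ∑ v, (if v ∈ S then k else 0) = #S * k := by simp
  suffices h : optimalPebblingNumber G * (G.minDegree + 1) < 4 * Fintype.card V by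
    rw [lt_div_iff₀ (by positivity)]
    exact_mod_cast h
  by_cases hcover : S.biUnion N = univ
  · have hsolv : Solvable G 1 (fun v => if v ∈ S then 2 else 0) := by
      intro v
      obtain ⟨s, hs, hvs⟩ := mem_biUnion.1 (hcover ▸ mem_univ v)
      rcases mem_insert.1 hvs with rfl | hsv
      · exact reachable_of_le (by simp [hs])
      · exact reachable_of_adj ((G.mem_neighborFinset s v).1 hsv) (by simp [hs])
    have hle := optimalPebblingNumber_le hsolv
    rw [hsum] at hle
    rw [hcover, card_univ] at hlower
    have hpos : 0 < Fintype.card V := Fintype.card_pos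
    nlinarith
  · have hsolv : Solvable G 1 (fun v => if v ∈ S then 4 else 0) := by
      intro v
      obtain ⟨s, hs, hsv⟩ := hmax v
      obtain ⟨x, hxs, hxv⟩ := not_disjoint_iff.1 hsv
      rw [mem_insert, G.mem_neighborFinset] at hxs hxv
      rcases hxs with rfl | hsx <;> rcases hxv with rfl | hvx
      · exact reachable_of_le (by simp [hs])
      · exact reachable_of_adj hvx.symm (by simp [hs])
      · exact reachable_of_adj hsx (by simp [hs])
      · exact reachable_of_adj_adj hsx hvx.symm (by simp [hs])
    have hle := optimalPebblingNumber_le hsolv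
    rw [hsum] at hle
    have hlt : #(S.biUnion N) < Fintype.card V :=
      lt_of_le_of_ne (card_le_univ _) fun h => hcover ((card_eq_iff_eq_univ _).1 h)
    nlinarith

/-- A weight that at most doubles along edges gives a quantity that pebbling moves do not
increase. -/
theorem PebblingMove.sum_mul_le [Fintype V] {D D' : V → ℕ} {W : V → ℕ}
    (hW : ∀ u v, G.Adj u v → W v ≤ 2 * W u) (h : PebblingMove G D D') :
    ∑ x, D' x * W x ≤ ∑ x, D x * W x := by
  classical
  obtain ⟨u, v, huv, hu, hv, hrest⟩ := h
  have hvu : v ∈ univ.erase u := by simp [huv.ne']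
  have split (f : V → ℕ) : ∑ x, f x = f u + (f v + ∑ x ∈ (univ.erase u).erase v, f x) := by
    rw [add_sum_erase _ f hvu, add_sum_erase _ f (mem_univ u)]
  have hcongr : ∑ x ∈ (univ.erase u).erase v, D' x * W x
      = ∑ x ∈ (univ.erase u).erase v, D x * W x :=
    sum_congr rfl fun x hx => by
      rw [hrest x (ne_of_mem_erase (mem_of_mem_erase hx)) (ne_of_mem_erase hx)]
  rw [split, split fun x => D x * W x, hcongr, hu, hv]
  have := hW u v huv
  nlinarith

theorem sum_mul_le_of_reflTransGen [Fintype V] {D D' : V → ℕ} {W : V → ℕ}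
    (hW : ∀ u v, G.Adj u v → W v ≤ 2 * W u)
    (h : Relation.ReflTransGen (PebblingMove G) D D') :
    ∑ x, D' x * W x ≤ ∑ x, D x * W x := by
  induction h with
  | refl => exact le_rfl
  | tail _ h ih => exact (h.sum_mul_le hW).trans ih

/-- With at most three pebbles, either no move is possible and some vertex stays empty, or the
pebbles occupy at most two vertices, whose common non-neighbour is out of reach. -/
theorem four_le_optimalPebblingNumber [Fintype V] (hcard : 4 ≤ Fintype.card V)
    (hG : ∀ u v, ∃ w, w ≠ u ∧ w ≠ v ∧ ¬ G.Adj w u ∧ ¬ G.Adj w v) :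
    4 ≤ optimalPebblingNumber G := by
  classical
  obtain ⟨D, hD, hsize⟩ := (isLeast_optimalPebblingNumberK G 1).1
  change 4 ≤ optimalPebblingNumberK G 1
  by_contra! hlt
  rw [← hsize] at hlt
  by_cases htwo : ∃ u, 2 ≤ D u
  · obtain ⟨u, hu⟩ := htwo
    have hsupp : ∃ v, ∀ x, x ≠ u → x ≠ v → D x = 0 := by
      by_cases hv : ∃ v, v ≠ u ∧ D v ≠ 0
      · obtain ⟨v, hvu, hDv⟩ := hv
        refine ⟨v, fun x hxu hxv => ?_⟩
        have hle : ∑ y ∈ {u, v, x}, D y ≤ ∑ y, D y :=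
          sum_le_sum_of_subset (subset_univ _)
        rw [sum_insert (by simp [hvu.symm, hxu.symm]), sum_pair hxv.symm] at hle
        omega
      · push Not at hv
        exact ⟨u, fun x hxu _ => hv x hxu⟩
    obtain ⟨v, hsupp⟩ := hsupp
    obtain ⟨w, hwu, hwv, hnu, hnv⟩ := hG u v
    -- A pebble on `w` weighs 4, but all initial pebbles lie at distance at least two from `w` and
    -- weigh 1 each, at most 3 in total.
    set W : V → ℕ := fun x => if x = w then 4 else if G.Adj w x then 2 else 1 with hWdef
    have hW : ∀ x y, G.Adj x y → W y ≤ 2 * W x := by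
      intro x y hxy
      simp only [hWdef]
      split_ifs <;> first | omega | (subst_vars; exact absurd hxy.symm ‹_›)
    obtain ⟨D', hDD', hw⟩ := hD w
    have hmono := sum_mul_le_of_reflTransGen hW hDD'
    have hle : D' w * W w ≤ ∑ x, D' x * W x :=
      single_le_sum (f := fun x => D' x * W x) (fun _ _ => Nat.zero_le _) (mem_univ w)
    have heq : ∑ x, D x * W x = ∑ x, D x := by
      refine sum_congr rfl fun x _ => ?_
      by_cases hxu : x = u
      · subst hxu; simp [hWdef, hwu.symm, hnu]
      by_cases hxv : x = v
      · subst hxv; simp [hWdef, hwv.symm, hnv]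
      · simp [hsupp x hxu hxv]
    have hWw : W w = 4 := by simp [hWdef]
    rw [hWw] at hle
    omega
  · push Not at htwo
    have hpos (v : V) : 1 ≤ D v := by
      obtain ⟨D', hDD', hv⟩ := hD v
      rcases hDD'.cases_head with rfl | ⟨E, ⟨u, _, _, hu, _⟩, _⟩
      · exact hv
      · have := htwo u; omega
    have hle : ∑ _v : V, 1 ≤ ∑ v, D v := sum_le_sum fun v _ => hpos v
    simp only [sum_const, card_univ, smul_eq_mul, mul_one] at hle
    omega

/-- The complement of the `m × m` rook's graph: cells are adjacent when they share neither row nor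
column. -/
def rookCompl (m : ℕ) : SimpleGraph (Fin (m * m)) where
  Adj x y := x.divNat ≠ y.divNat ∧ x.modNat ≠ y.modNat
  symm := ⟨fun _ _ h => ⟨h.1.symm, h.2.symm⟩⟩
  loopless := ⟨fun _ h => h.1 rfl⟩

instance (m : ℕ) : DecidableRel (rookCompl m).Adj :=
  fun x y => inferInstanceAs (Decidable (x.divNat ≠ y.divNat ∧ x.modNat ≠ y.modNat))

theorem rookCompl_adj {m : ℕ} {x y : Fin (m * m)} :
    (rookCompl m).Adj x y ↔ x.divNat ≠ y.divNat ∧ x.modNat ≠ y.modNat := Iff.rfl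

theorem exists_divNat_modNat {m : ℕ} (a b : Fin m) :
    ∃ x : Fin (m * m), x.divNat = a ∧ x.modNat = b :=
  ⟨finProdFinEquiv (a, b), congrArg Prod.fst (finProdFinEquiv.symm_apply_apply (a, b)),
    congrArg Prod.snd (finProdFinEquiv.symm_apply_apply (a, b))⟩

theorem exists_ne_ne {m : ℕ} (hm : 3 ≤ m) (a b : Fin m) : ∃ c, c ≠ a ∧ c ≠ b := by
  have : #({a, b} : Finset (Fin m)) < #(univ : Finset (Fin m)) := by
    rw [card_univ, Fintype.card_fin]
    exact card_le_two.trans_lt hm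
  obtain ⟨c, -, hc⟩ := exists_mem_notMem_of_card_lt_card this
  exact ⟨c, by simpa using hc⟩

theorem rookCompl_exists_common_neighbor {m : ℕ} (hm : 3 ≤ m) (x y : Fin (m * m)) :
    ∃ z, (rookCompl m).Adj x z ∧ (rookCompl m).Adj z y := by
  obtain ⟨a, hax, hay⟩ := exists_ne_ne hm x.divNat y.divNat
  obtain ⟨b, hbx, hby⟩ := exists_ne_ne hm x.modNat y.modNat
  obtain ⟨z, rfl, rfl⟩ := exists_divNat_modNat a b
  exact ⟨z, ⟨hax.symm, hbx.symm⟩, hay, hby⟩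

/-- Non-adjacent means sharing a line: take a third cell of a common row or column, or else the cell
where the row of `x` meets the column of `y`. -/
theorem rookCompl_exists_common_nonneighbor {m : ℕ} (hm : 3 ≤ m) (x y : Fin (m * m)) :
    ∃ w, w ≠ x ∧ w ≠ y ∧ ¬ (rookCompl m).Adj w x ∧ ¬ (rookCompl m).Adj w y := by
  by_cases hrow : x.divNat = y.divNat
  · obtain ⟨b, hbx, hby⟩ := exists_ne_ne hm x.modNat y.modNat
    obtain ⟨w, hw, rfl⟩ := exists_divNat_modNat x.divNat b
    exact ⟨w, fun h => hbx (h ▸ rfl), fun h => hby (h ▸ rfl), fun h => h.1 hw,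
      fun h => h.1 (hw.trans hrow)⟩
  by_cases hcol : x.modNat = y.modNat
  · obtain ⟨a, hax, hay⟩ := exists_ne_ne hm x.divNat y.divNat
    obtain ⟨w, rfl, hw⟩ := exists_divNat_modNat a x.modNat
    exact ⟨w, fun h => hax (h ▸ rfl), fun h => hay (h ▸ rfl), fun h => h.2 hw,
      fun h => h.2 (hw.trans hcol)⟩
  · obtain ⟨w, hw, hw'⟩ := exists_divNat_modNat x.divNat y.modNat
    refine ⟨w, fun h => hcol ?_, fun h => hrow ?_, fun h => h.1 hw, fun h => h.2 hw'⟩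
    · rw [← hw', h]
    · rw [← hw, h]

theorem rookCompl_connected {m : ℕ} (hm : 3 ≤ m) : (rookCompl m).Connected := by
  have : Nonempty (Fin (m * m)) := ⟨⟨0, by positivity⟩⟩
  refine ⟨fun x y => ?_⟩
  obtain ⟨z, hxz, hzy⟩ := rookCompl_exists_common_neighbor hm x y
  exact hxz.reachable.trans hzy.reachable

theorem rookCompl_diam {m : ℕ} (hm : 3 ≤ m) : (rookCompl m).diam = 2 := by
  have hconn := rookCompl_connected hm
  have : Nonempty (Fin (m * m)) := hconn.nonempty
  apply le_antisymm
  · obtain ⟨x, y, hxy⟩ := (rookCompl m).exists_dist_eq_diam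
    obtain ⟨z, hxz, hzy⟩ := rookCompl_exists_common_neighbor hm x y
    rw [← hxy]
    exact SimpleGraph.dist_le (.cons hxz (.cons hzy .nil))
  · obtain ⟨x⟩ := hconn.nonempty
    obtain ⟨w, hwx, -, hadj, -⟩ := rookCompl_exists_common_nonneighbor hm x x
    have hle := SimpleGraph.dist_le_diam (SimpleGraph.connected_iff_ediam_ne_top.1 hconn)
      (u := w) (v := x)
    have hpos := hconn.pos_dist_of_ne hwx
    have hone : (rookCompl m).dist w x ≠ 1 := fun h => hadj (SimpleGraph.dist_eq_one_iff_adj.1 h)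
    omega

theorem rookCompl_degree {m : ℕ} (x : Fin (m * m)) :
    (rookCompl m).degree x = (m - 1) * (m - 1) := by
  have h : (rookCompl m).neighborFinset x
      = (univ.erase x.divNat ×ˢ univ.erase x.modNat).map finProdFinEquiv.toEmbedding := by
    ext y
    rw [SimpleGraph.mem_neighborFinset, rookCompl_adj, mem_map_equiv]
    simp [eq_comm]
  rw [← SimpleGraph.card_neighborFinset_eq_degree, h, card_map, card_product]
  simp

theorem rookCompl_minDegree {m : ℕ} (hm : 3 ≤ m) :
    (rookCompl m).minDegree = (m - 1) * (m - 1) := by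
  have : Nonempty (Fin (m * m)) := (rookCompl_connected hm).nonempty
  obtain ⟨x, hx⟩ := (rookCompl m).exists_minimal_degree_vertex
  rw [hx, rookCompl_degree]

theorem exists_diam_eq_two_lt {ε : ℝ} (hε : 0 < ε) :
    ∃ (n : ℕ) (G : SimpleGraph (Fin n)) (_ : DecidableRel G.Adj),
      G.Connected ∧ G.diam = 2 ∧
      4 - ε < (optimalPebblingNumber G : ℝ) * ((G.minDegree : ℝ) + 1) / (n : ℝ) := by
  -- The deficit `4m² - 4((m - 1)² + 1) = 8m - 8` is below `εm²` once `m > 8 / ε`.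
  obtain ⟨k, hk⟩ := exists_nat_gt (8 / ε)
  set m := k + 3 with hmdef
  have hm : 3 ≤ m := by omega
  refine ⟨m * m, rookCompl m, inferInstance, rookCompl_connected hm, rookCompl_diam hm, ?_⟩
  have hfour : (4 : ℝ) ≤ optimalPebblingNumber (rookCompl m) := by
    exact_mod_cast four_le_optimalPebblingNumber (by rw [Fintype.card_fin]; nlinarith)
      (rookCompl_exists_common_nonneighbor hm)
  have hmε : 8 < m * ε := by
    rw [div_lt_iff₀ hε] at hk
    have : (k : ℝ) ≤ m := by exact_mod_cast (by omega : k ≤ m)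
    nlinarith
  have hpos : (0 : ℝ) < m := by exact_mod_cast (by omega : 0 < m)
  rw [rookCompl_minDegree hm, Nat.cast_mul, Nat.cast_mul, Nat.cast_sub (by omega : 1 ≤ m),
    Nat.cast_one, lt_div_iff₀ (by positivity)]
  calc (4 - ε) * ((m : ℝ) * m) < 4 * (((m : ℝ) - 1) * (m - 1) + 1) := by nlinarith
    _ ≤ _ := mul_le_mul_of_nonneg_right hfour (by nlinarith [mul_self_nonneg ((m : ℝ) - 1)])

end Pebbling

theorem mainTheorem2 :
    (∀ (V : Type*) [Fintype V] (G : SimpleGraph V) [DecidableRel G.Adj], G.Connected →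
      (Pebbling.optimalPebblingNumber G : ℝ)
        < 4 * (Fintype.card V : ℝ) / ((G.minDegree : ℝ) + 1)) ∧
    (∀ ε : ℝ, 0 < ε →
      ∃ (n : ℕ) (G : SimpleGraph (Fin n)) (_ : DecidableRel G.Adj),
        G.Connected ∧ G.diam = 2 ∧
        4 - ε < (Pebbling.optimalPebblingNumber G : ℝ) * ((G.minDegree : ℝ) + 1) / (n : ℝ)) := by
  refine ⟨fun V _ G _ hG => ?_, fun ε hε => Pebbling.exists_diam_eq_two_lt hε⟩
  have := hG.nonempty
  exact Pebbling.optimalPebblingNumber_lt G
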